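/- Let $A$ be a unital $C^*$-algebra and let $\alpha\colon\mathbb{T}\to\mathrm{Aut}(A)$ be an action of the circle group, that is, a group homomorphism such that $\zeta\mapsto\alpha_\zeta(a)$ is norm continuous for every $a\in A$. Suppose that $\alpha$ has the Rokhlin property: for every $\varepsilon>0$ and every finite subset $F\subseteq A$ there is a unitary $u\in A$ such that $\|\alpha_\zeta(u)-\zeta u\|<\varepsilon$ for all $\zeta\in\mathbb{T}$ and $\|ua-au\|<\varepsilon$ for all $a\in F$. Write $A^\alpha=\{a\in A:\alpha_\zeta(a)=a\text{ for all }\zeta\in\mathbb{T}\}$ for the fixed point algebra. For an automorphism $\theta$ of $A^\alpha$, the crossed product $A^\alpha\rtimes_\theta\mathbb{Z}$ is the enveloping $C^*$-algebra of $\ell^1(\mathbb{Z},A^\alpha)$ with the operations $(a*b)(n)=\sum_{k}a(k)\,\theta^k(b(n-k))$ and $a^*(n)=\theta^n(a(-n)^*)$; it contains $A^\alpha$ (as the functions supported at $0$), and its dual action $\widehat\theta\colon\mathbb{T}\to\mathrm{Aut}(A^\alpha\rtimes_\theta\mathbb{Z})$ is determined by $\widehat\theta_\zeta(a)(n)=\zeta^n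 a(n)$. Then there exist an automorphism $\theta$ of $A^\alpha$ and an isomorphism $\varphi\colon A^\alpha\rtimes_\theta\mathbb{Z}\to A$ such that $\varphi\circ\widehat\theta_\zeta=\alpha_\zeta\circ\varphi$ for all $\zeta\in\mathbb{T}$ and $\varphi$ is the identity on $A^\alpha$. Moreover, $\theta$ is unique up to unitary equivalence: if $\theta,\theta'$ are automorphisms of $A^\alpha$ and $\varphi\colon(A^\alpha\rtimes_\theta\mathbb{Z},\widehat\theta)\to(A,\alpha)$ and $\varphi'\colon(A^\alpha\rtimes_{\theta'}\mathbb{Z},\widehat{\theta'})\to(A,\alpha)$ are equivariant isomorphisms that are the identity on $A^\alpha$, then there is a unitary $w\in A^\alpha$ such that $\theta(b)=w\,\theta'(b)\,w^*$ for all $b\in A^\alpha$. -/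

import Mathlib

/-! ## Circle actions and the Rokhlin property -/

namespace CircleAction

variable {A : Type*} [CStarAlgebra A]

/-- The fixed point algebra `A^α = {a | α_ζ(a) = a for all ζ}` of an action of the circle. -/
def fixedPoints (α : Circle →* (A ≃⋆ₐ[ℂ] A)) : StarSubalgebra ℂ A where
  carrier := {a | ∀ ζ : Circle, α ζ a = a}
  mul_mem' ha hb ζ := by rw [map_mul, ha ζ, hb ζ]
  one_mem' ζ := map_one (α ζ)
  add_mem' ha hb ζ := by rw [map_add, ha ζ, hb ζ]
  zero_mem' ζ := map_zero (α ζ)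
  algebraMap_mem' c ζ := by
    rw [Algebra.algebraMap_eq_smul_one, map_smul, map_one]
  star_mem' ha ζ := by rw [map_star, ha ζ]

theorem mem_fixedPoints {α : Circle →* (A ≃⋆ₐ[ℂ] A)} {a : A} :
    a ∈ fixedPoints α ↔ ∀ ζ : Circle, α ζ a = a := Iff.rfl

/-- Makes `fixedPoints α` a unital C⋆-algebra, through `StarSubalgebra.cstarAlgebra`. -/
instance isClosed_fixedPoints (α : Circle →* (A ≃⋆ₐ[ℂ] A)) :
    IsClosed (fixedPoints α : Set A) := by
  have h : (fixedPoints α : Set A) = ⋂ ζ : Circle, {a | α ζ a = a} := by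
    ext a; simp [mem_fixedPoints]
  rw [h]
  exact isClosed_iInter fun ζ =>
    isClosed_eq (StarAlgEquiv.isometry (α ζ)).continuous continuous_id

/-- The Rokhlin property for an action of the circle on a unital C⋆-algebra. -/
def HasRokhlinProperty (α : Circle →* (A ≃⋆ₐ[ℂ] A)) : Prop :=
  ∀ ε : ℝ, 0 < ε → ∀ F : Finset A, ∃ u ∈ unitary A,
    (∀ ζ : Circle, ‖α ζ u - (ζ : ℂ) • u‖ < ε) ∧ ∀ a ∈ F, ‖u * a - a * u‖ < ε

end CircleAction

/-! ## The crossed product of a unital C⋆-algebra by an automorphism -/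

/-- A *C⋆-seminorm* on a complex `⋆`-algebra. -/
structure IsCStarSeminorm {L : Type*} [Ring L] [StarRing L] [Module ℂ L] (p : Seminorm ℂ L) :
    Prop where
  mul_le : ∀ x y, p (x * y) ≤ p x * p y
  star_mul_self : ∀ x, p (star x * x) = p x ^ 2

theorem IsCStarSeminorm.map_star {L : Type*} [Ring L] [StarRing L] [Module ℂ L]
    {p : Seminorm ℂ L} (hp : IsCStarSeminorm p) (x : L) : p (star x) = p x := by
  have key : ∀ y, p y ≤ p (star y) := by
    intro y
    by_contra hlt
    push Not at hlt
    have h1 := hp.mul_le (star y) y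
    rw [hp.star_mul_self] at h1
    have h2 := apply_nonneg p (star y)
    nlinarith
  refine le_antisymm ?_ (key x)
  simpa using key (star x)

namespace CStarCrossedProduct

variable {B : Type*} [CStarAlgebra B]

/-- The group `ℤ` (written multiplicatively), acting on `B` through the powers of `θ`. -/
def IntAct (_θ : B ≃⋆ₐ[ℂ] B) : Type := Multiplicative ℤ

variable (θ : B ≃⋆ₐ[ℂ] B)

noncomputable instance : CommGroup (IntAct θ) := inferInstanceAs (CommGroup (Multiplicative ℤ))

/-- The integer `n` as an element of the acting group. -/
def IntAct.of (n : ℤ) : IntAct θ := Multiplicative.ofAdd n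

variable {θ} in
/-- The integer underlying an element of the acting group. -/
def IntAct.toInt (n : IntAct θ) : ℤ := Multiplicative.toAdd n

noncomputable instance : MulSemiringAction (IntAct θ) B where
  smul n b := (θ ^ n.toInt) b
  one_smul b := by
    change (θ ^ (0 : ℤ)) b = b
    simp
  mul_smul m n b := by
    change (θ ^ (m.toInt + n.toInt)) b = (θ ^ m.toInt) ((θ ^ n.toInt) b)
    rw [zpow_add]; rfl
  smul_zero n := map_zero (θ ^ n.toInt)
  smul_add n := map_add (θ ^ n.toInt)
  smul_one n := map_one (θ ^ n.toInt)
  smul_mul n := map_mul (θ ^ n.toInt)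

variable {θ} in
theorem IntAct.smul_def (n : IntAct θ) (b : B) : n • b = (θ ^ n.toInt) b := rfl

/-- The algebra `C_c(ℤ, B, θ)` of finitely supported functions `ℤ → B`, with the twisted
convolution `(a * b)(n) = ∑ k, a(k) θ^k(b(n - k))`. -/
abbrev ConvAlg : Type _ := SkewMonoidAlgebra B (IntAct θ)

namespace ConvAlg

open SkewMonoidAlgebra

variable {θ}

theorem ext_add {M : Type*} [AddCommMonoid M] {f g : ConvAlg θ →+ M}
    (h : ∀ n b, f (single n b) = g (single n b)) (x : ConvAlg θ) : f x = g x :=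
  DFunLike.congr_fun (SkewMonoidAlgebra.addHom_ext h) x

/-- The underlying additive map of the involution: `b δ_n ↦ θ^{-n}(b⋆) δ_{-n}`. -/
noncomputable def starAdd : ConvAlg θ →+ ConvAlg θ where
  toFun x := x.sum fun n b => single n⁻¹ (n⁻¹ • star b)
  map_zero' := by simp
  map_add' x y := SkewMonoidAlgebra.sum_add_index' (by simp)
    (by intro n b c; rw [star_add, smul_add, single_add])

theorem starAdd_single (n : IntAct θ) (b : B) :
    starAdd (single n b) = single n⁻¹ (n⁻¹ • star b) := by
  change (single n b).sum (fun n b => single n⁻¹ (n⁻¹ • star b)) = _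
  rw [SkewMonoidAlgebra.sum_single_index (by simp)]

/-- The involution of `C_c(ℤ, B, θ)`, `a⋆(n) = θ^n(a(-n)⋆)`. -/
noncomputable instance : Star (ConvAlg θ) := ⟨fun x => starAdd x⟩

theorem star_single (n : IntAct θ) (b : B) :
    star (single n b : ConvAlg θ) = single n⁻¹ (n⁻¹ • star b) := starAdd_single n b

theorem star_smul_coeff (n : IntAct θ) (b : B) : star (n • b) = n • star b :=
  (map_star (θ ^ n.toInt) b).symm

theorem single_mul_single' (m n : IntAct θ) (a b : B) :
    (single m a : ConvAlg θ) * single n b = single (m * n) (a * m • b) :=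
  SkewMonoidAlgebra.single_mul_single

noncomputable instance : StarRing (ConvAlg θ) where
  star_involutive x := by
    refine ext_add (f := starAdd.comp starAdd) (g := AddMonoidHom.id _) (fun n b => ?_) x
    simp [starAdd_single, star_smul_coeff]
  star_add x y := map_add starAdd x y
  star_mul x y := by
    induction x using SkewMonoidAlgebra.induction_on' with
    | add x x' hx hx' =>
      change starAdd ((x + x') * y) = starAdd y * starAdd (x + x')
      rw [add_mul, map_add, map_add, mul_add]
      exact congrArg₂ _ hx hx'
    | single m a =>
      induction y using SkewMonoidAlgebra.induction_on' with
      | add y y' hy hy' =>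
        change starAdd (_ * (y + y')) = starAdd (y + y') * starAdd _
        rw [mul_add, map_add, map_add, add_mul]
        exact congrArg₂ _ hy hy'
      | single n b =>
        rw [single_mul_single', star_single, star_single, star_single, single_mul_single']
        simp [mul_comm, smul_smul, star_smul_coeff]

theorem smul_comm_coeff (c : ℂ) (n : IntAct θ) (b : B) : n • c • b = c • n • b :=
  map_smul (θ ^ n.toInt) c b

noncomputable instance : StarModule ℂ (ConvAlg θ) where
  star_smul c x := by
    induction x using SkewMonoidAlgebra.induction_on' with
    | add x y hx hy => rw [smul_add, star_add, star_add, hx, hy, smul_add]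
    | single n b =>
      rw [smul_single, star_single, star_single, smul_single, star_smul, smul_comm_coeff]

noncomputable instance : Algebra ℂ (ConvAlg θ) :=
  Algebra.ofModule
    (fun c x y => by
      induction x using SkewMonoidAlgebra.induction_on' with
      | add x x' hx hx' => rw [smul_add, add_mul, hx, hx', add_mul, smul_add]
      | single m a =>
        induction y using SkewMonoidAlgebra.induction_on' with
        | add y y' hy hy' => rw [mul_add, hy, hy', mul_add, smul_add]
        | single n b =>
          rw [smul_single, single_mul_single', single_mul_single', smul_single, smul_mul_assoc])
    (fun c x y => by
      induction x using SkewMonoidAlgebra.induction_on' with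
      | add x x' hx hx' => rw [add_mul, hx, hx', add_mul, smul_add]
      | single m a =>
        induction y using SkewMonoidAlgebra.induction_on' with
        | add y y' hy hy' => rw [smul_add, mul_add, hy, hy', mul_add, smul_add]
        | single n b =>
          rw [smul_single, single_mul_single', single_mul_single', smul_single, smul_comm_coeff,
            mul_smul_comm])

/-- The `ℓ¹`-norm `∑ n, ‖a(n)‖`. -/
noncomputable def l1Norm (x : ConvAlg θ) : ℝ := x.sum fun _ b => ‖b‖

variable (θ) in
/-- The C⋆-seminorms on `C_c(ℤ, B, θ)` dominated by the `ℓ¹`-norm. By continuous extension these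
are the same as the C⋆-seminorms of the Banach `⋆`-algebra `ℓ¹(ℤ, B, θ)`. -/
def BddCStarSeminorm : Type _ :=
  {p : Seminorm ℂ (ConvAlg θ) // IsCStarSeminorm p ∧ ∀ x, p x ≤ l1Norm x}

theorem l1Norm_nonneg (x : ConvAlg θ) : 0 ≤ l1Norm x :=
  Finset.sum_nonneg fun _ _ => norm_nonneg _

noncomputable instance : Inhabited (BddCStarSeminorm θ) :=
  ⟨⟨0, ⟨fun _ _ => by simp, fun _ => by simp⟩, fun x => by simpa using l1Norm_nonneg x⟩⟩

/-- The universal C⋆-seminorm: the supremum of all C⋆-seminorms dominated by the `ℓ¹`-norm. -/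
noncomputable def univNorm (x : ConvAlg θ) : ℝ := ⨆ p : BddCStarSeminorm θ, p.1 x

theorem bddAbove_seminorms (x : ConvAlg θ) :
    BddAbove (Set.range fun p : BddCStarSeminorm θ => p.1 x) :=
  ⟨l1Norm x, by rintro _ ⟨p, rfl⟩; exact p.2.2 x⟩

theorem le_univNorm (p : BddCStarSeminorm θ) (x : ConvAlg θ) : p.1 x ≤ univNorm x :=
  le_ciSup (bddAbove_seminorms x) p

theorem univNorm_nonneg (x : ConvAlg θ) : 0 ≤ univNorm x :=
  Real.iSup_nonneg fun p => apply_nonneg p.1 x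

theorem univNorm_add_le (x y : ConvAlg θ) : univNorm (x + y) ≤ univNorm x + univNorm y :=
  ciSup_le fun p => (map_add_le_add p.1 x y).trans (add_le_add (le_univNorm p x) (le_univNorm p y))

theorem univNorm_neg (x : ConvAlg θ) : univNorm (-x) = univNorm x :=
  iSup_congr fun p => map_neg_eq_map p.1 x

theorem univNorm_mul_le (x y : ConvAlg θ) : univNorm (x * y) ≤ univNorm x * univNorm y :=
  ciSup_le fun p => (p.2.1.mul_le x y).trans
    (mul_le_mul (le_univNorm p x) (le_univNorm p y) (apply_nonneg p.1 y) (univNorm_nonneg x))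

theorem univNorm_smul_le (c : ℂ) (x : ConvAlg θ) : univNorm (c • x) ≤ ‖c‖ * univNorm x :=
  ciSup_le fun p => by
    rw [map_smul_eq_mul]
    exact mul_le_mul_of_nonneg_left (le_univNorm p x) (norm_nonneg c)

theorem univNorm_star (x : ConvAlg θ) : univNorm (star x) = univNorm x :=
  iSup_congr fun p => p.2.1.map_star x

theorem univNorm_sq_le (x : ConvAlg θ) : univNorm x * univNorm x ≤ univNorm (star x * x) := by
  have h : univNorm x ≤ Real.sqrt (univNorm (star x * x)) :=
    ciSup_le fun p => Real.le_sqrt_of_sq_le <| by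
      rw [← p.2.1.star_mul_self]; exact le_univNorm p _
  calc univNorm x * univNorm x
      ≤ Real.sqrt (univNorm (star x * x)) * Real.sqrt (univNorm (star x * x)) :=
        mul_self_le_mul_self (univNorm_nonneg x) h
    _ = univNorm (star x * x) := Real.mul_self_sqrt (univNorm_nonneg _)

/-- `C_c(ℤ, B, θ)` with the universal C⋆-seminorm. -/
noncomputable instance : SeminormedRing (ConvAlg θ) where
  __ := (inferInstance : Ring (ConvAlg θ))
  __ := ({ toFun := univNorm
           map_zero' := le_antisymm (ciSup_le fun p => by simp) (univNorm_nonneg 0)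
           add_le' := univNorm_add_le
           neg' := univNorm_neg } : AddGroupSeminorm (ConvAlg θ)).toSeminormedAddCommGroup
  norm_mul_le := univNorm_mul_le

theorem norm_def (x : ConvAlg θ) : ‖x‖ = univNorm x := rfl

noncomputable instance : NormedAlgebra ℂ (ConvAlg θ) where
  norm_smul_le := univNorm_smul_le

instance : NormedStarGroup (ConvAlg θ) where
  norm_star_le x := (univNorm_star x).le

end ConvAlg

end CStarCrossedProduct

/-- The crossed product `B ⋊_θ ℤ`, that is, the enveloping C⋆-algebra of `ℓ¹(ℤ, B, θ)`: the
(Hausdorff) completion of `C_c(ℤ, B, θ)` in the universal C⋆-seminorm. -/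
def CStarCrossedProduct {B : Type*} [CStarAlgebra B] (θ : B ≃⋆ₐ[ℂ] B) : Type _ :=
  UniformSpace.Completion (CStarCrossedProduct.ConvAlg θ)

namespace CStarCrossedProduct

open UniformSpace

variable {B : Type*} [CStarAlgebra B] {θ : B ≃⋆ₐ[ℂ] B}

noncomputable instance : NormedRing (CStarCrossedProduct θ) :=
  inferInstanceAs (NormedRing (Completion (ConvAlg θ)))

instance : CompleteSpace (CStarCrossedProduct θ) :=
  inferInstanceAs (CompleteSpace (Completion (ConvAlg θ)))

noncomputable instance : Algebra ℂ (CStarCrossedProduct θ) :=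
  inferInstanceAs (Algebra ℂ (Completion (ConvAlg θ)))

/-- The canonical map `C_c(ℤ, B, θ) → B ⋊_θ ℤ`. -/
noncomputable def ofConv (x : ConvAlg θ) : CStarCrossedProduct θ := (x : Completion (ConvAlg θ))

theorem denseRange_ofConv : DenseRange (ofConv (θ := θ)) := Completion.denseRange_coe

theorem continuous_ofConv : Continuous (ofConv (θ := θ)) := Completion.continuous_coe _

theorem norm_ofConv (x : ConvAlg θ) : ‖ofConv x‖ = ConvAlg.univNorm x := Completion.norm_coe x

theorem ofConv_add (x y : ConvAlg θ) : ofConv (x + y) = ofConv x + ofConv y :=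
  Completion.coe_add x y

theorem ofConv_mul (x y : ConvAlg θ) : ofConv (x * y) = ofConv x * ofConv y :=
  Completion.coe_mul x y

theorem ofConv_one : ofConv (1 : ConvAlg θ) = 1 := rfl

theorem ofConv_zero : ofConv (0 : ConvAlg θ) = 0 := rfl

theorem ofConv_smul (c : ℂ) (x : ConvAlg θ) : ofConv (c • x) = c • ofConv x :=
  Completion.coe_smul c x

theorem induction_ofConv {P : CStarCrossedProduct θ → Prop} (x : CStarCrossedProduct θ)
    (hc : IsClosed {x | P x}) (h : ∀ y, P (ofConv y)) : P x :=
  Completion.induction_on (α := ConvAlg θ) x hc h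

theorem induction_ofConv₂ {P : CStarCrossedProduct θ → CStarCrossedProduct θ → Prop}
    (x y : CStarCrossedProduct θ)
    (hc : IsClosed {z : CStarCrossedProduct θ × CStarCrossedProduct θ | P z.1 z.2})
    (h : ∀ a b, P (ofConv a) (ofConv b)) : P x y :=
  Completion.induction_on₂ (α := ConvAlg θ) (β := ConvAlg θ) x y hc h

noncomputable instance : NormedAlgebra ℂ (CStarCrossedProduct θ) where
  norm_smul_le := fun c x => norm_smul_le (β := Completion (ConvAlg θ)) c x

noncomputable instance : Star (CStarCrossedProduct θ) :=
  ⟨Completion.map (star : ConvAlg θ → ConvAlg θ)⟩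

theorem ofConv_star (x : ConvAlg θ) : ofConv (star x) = star (ofConv x) :=
  (Completion.map_coe (star_isometry (E := ConvAlg θ)).uniformContinuous x).symm

theorem continuous_star_aux :
    Continuous (star : CStarCrossedProduct θ → CStarCrossedProduct θ) :=
  Completion.continuous_map

noncomputable instance : StarRing (CStarCrossedProduct θ) where
  star_involutive x := by
    refine induction_ofConv (P := fun x => star (star x) = x) x
      (isClosed_eq (continuous_star_aux.comp continuous_star_aux) continuous_id) fun y => ?_
    rw [← ofConv_star, ← ofConv_star, star_star]
  star_mul x y := by
    refine induction_ofConv₂ (P := fun x y => star (x * y) = star y * star x) x y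
      (isClosed_eq (continuous_star_aux.comp (continuous_fst.mul continuous_snd))
        ((continuous_star_aux.comp continuous_snd).mul (continuous_star_aux.comp continuous_fst)))
      fun a b => ?_
    rw [← ofConv_mul, ← ofConv_star, star_mul, ofConv_mul, ofConv_star, ofConv_star]
  star_add x y := by
    refine induction_ofConv₂ (P := fun x y => star (x + y) = star x + star y) x y
      (isClosed_eq (continuous_star_aux.comp (continuous_fst.add continuous_snd))
        ((continuous_star_aux.comp continuous_fst).add (continuous_star_aux.comp continuous_snd)))
      fun a b => ?_
    rw [← ofConv_add, ← ofConv_star, star_add, ofConv_add, ofConv_star, ofConv_star]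

instance : StarModule ℂ (CStarCrossedProduct θ) where
  star_smul c x := by
    refine induction_ofConv (P := fun x => star (c • x) = star c • star x) x
      (isClosed_eq (continuous_star_aux.comp (continuous_const_smul c))
        (continuous_star_aux.const_smul (star c))) fun y => ?_
    rw [← ofConv_smul, ← ofConv_star, star_smul, ofConv_smul, ofConv_star]

instance : CStarRing (CStarCrossedProduct θ) where
  norm_mul_self_le x := by
    refine induction_ofConv (P := fun x => ‖x‖ * ‖x‖ ≤ ‖star x * x‖) x
      (isClosed_le (continuous_norm.mul continuous_norm)
        (continuous_norm.comp (continuous_star_aux.mul continuous_id))) fun y => ?_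
    rw [← ofConv_star, ← ofConv_mul, norm_ofConv, norm_ofConv]
    exact ConvAlg.univNorm_sq_le y

noncomputable instance : CStarAlgebra (CStarCrossedProduct θ) where

variable (θ) in
/-- The canonical copy of `B` in `B ⋊_θ ℤ`. -/
noncomputable def incl (b : B) : CStarCrossedProduct θ :=
  ofConv (SkewMonoidAlgebra.single (IntAct.of θ 0) b)

variable (θ) in
/-- The canonical unitary of `B ⋊_θ ℤ`. -/
noncomputable def canonicalUnitary : CStarCrossedProduct θ :=
  ofConv (SkewMonoidAlgebra.single (IntAct.of θ 1) 1)

/-! ### The dual action -/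

open SkewMonoidAlgebra

/-- The underlying additive map of the dual action on `C_c(ℤ, B, θ)`: `b δ_n ↦ ζ^n b δ_n`. -/
noncomputable def dualConvAdd (ζ : Circle) : ConvAlg θ →+ ConvAlg θ where
  toFun x := x.sum fun n b => single n (((ζ ^ n.toInt : Circle) : ℂ) • b)
  map_zero' := by simp
  map_add' x y := SkewMonoidAlgebra.sum_add_index' (by simp)
    (by intro n b c; rw [smul_add, single_add])

theorem dualConvAdd_single (ζ : Circle) (n : IntAct θ) (b : B) :
    dualConvAdd ζ (single n b) = single n (((ζ ^ n.toInt : Circle) : ℂ) • b) := by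
  change (single n b).sum (fun n b => single n (((ζ ^ n.toInt : Circle) : ℂ) • b)) = _
  rw [SkewMonoidAlgebra.sum_single_index (by simp)]

theorem dualConvAdd_mul (ζ : Circle) (x y : ConvAlg θ) :
    dualConvAdd ζ (x * y) = dualConvAdd ζ x * dualConvAdd ζ y := by
  induction x using SkewMonoidAlgebra.induction_on' with
  | add x x' hx hx' => rw [add_mul, map_add, hx, hx', map_add, add_mul]
  | single m a =>
    induction y using SkewMonoidAlgebra.induction_on' with
    | add y y' hy hy' => rw [mul_add, map_add, hy, hy', map_add, mul_add]
    | single n b =>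
      have h : (m * n).toInt = m.toInt + n.toInt := rfl
      rw [ConvAlg.single_mul_single', dualConvAdd_single, dualConvAdd_single, dualConvAdd_single,
        ConvAlg.single_mul_single', ConvAlg.smul_comm_coeff, smul_mul_smul_comm, h, zpow_add,
        Circle.coe_mul]

theorem dualConvAdd_smul (ζ : Circle) (c : ℂ) (x : ConvAlg θ) :
    dualConvAdd ζ (c • x) = c • dualConvAdd ζ x := by
  induction x using SkewMonoidAlgebra.induction_on' with
  | add x x' hx hx' => rw [smul_add, map_add, hx, hx', map_add, smul_add]
  | single m a =>
    rw [smul_single, dualConvAdd_single, dualConvAdd_single, smul_single, smul_comm]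

theorem dualConvAdd_star (ζ : Circle) (x : ConvAlg θ) :
    dualConvAdd ζ (star x) = star (dualConvAdd ζ x) := by
  induction x using SkewMonoidAlgebra.induction_on' with
  | add x x' hx hx' => rw [star_add, map_add, hx, hx', map_add, star_add]
  | single n b =>
    have h : (n⁻¹).toInt = -n.toInt := rfl
    rw [dualConvAdd_single, ConvAlg.star_single, ConvAlg.star_single, dualConvAdd_single,
      star_smul, ConvAlg.smul_comm_coeff, h, zpow_neg, Circle.coe_inv_eq_conj]
    rfl

theorem dualConvAdd_one (x : ConvAlg θ) : dualConvAdd 1 x = x := by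
  refine ConvAlg.ext_add (g := AddMonoidHom.id _) (fun n b => ?_) x
  simp [dualConvAdd_single]

theorem dualConvAdd_comp (ζ η : Circle) (x : ConvAlg θ) :
    dualConvAdd (ζ * η) x = dualConvAdd ζ (dualConvAdd η x) := by
  refine ConvAlg.ext_add (g := (dualConvAdd ζ).comp (dualConvAdd η)) (fun n b => ?_) x
  rw [AddMonoidHom.comp_apply, dualConvAdd_single, dualConvAdd_single, dualConvAdd_single,
    smul_smul, mul_zpow, Circle.coe_mul]

theorem l1Norm_dualConvAdd (ζ : Circle) (x : ConvAlg θ) :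
    ConvAlg.l1Norm (dualConvAdd ζ x) = ConvAlg.l1Norm x := by
  have hc : ∀ n, (dualConvAdd ζ x).coeff n = ((ζ ^ n.toInt : Circle) : ℂ) • x.coeff n := by
    intro n
    classical
    induction x using SkewMonoidAlgebra.induction_on' with
    | add x x' hx hx' => rw [map_add, coeff_add, coeff_add, Finsupp.add_apply, Finsupp.add_apply,
        hx, hx', smul_add]
    | single m a =>
      rw [dualConvAdd_single, coeff_single_apply, coeff_single_apply]
      split_ifs with h
      · rw [h]
      · rw [smul_zero]
  have hs : (dualConvAdd ζ x).support = x.support := by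
    ext n
    rw [mem_support_iff, mem_support_iff, hc, ne_eq, ne_eq, smul_eq_zero,
      or_iff_right (Circle.coe_ne_zero _)]
  unfold ConvAlg.l1Norm
  rw [SkewMonoidAlgebra.sum_def', SkewMonoidAlgebra.sum_def', hs]
  refine Finset.sum_congr rfl fun n _ => ?_
  rw [hc, norm_smul, Circle.norm_coe, one_mul]

theorem univNorm_dualConvAdd_le (ζ : Circle) (x : ConvAlg θ) :
    ConvAlg.univNorm (dualConvAdd ζ x) ≤ ConvAlg.univNorm x :=
  ciSup_le fun p => by
    let q : Seminorm ℂ (ConvAlg θ) :=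
      { toFun := fun x => p.1 (dualConvAdd ζ x)
        map_zero' := by rw [map_zero, map_zero]
        add_le' := fun x y => by rw [map_add]; exact map_add_le_add p.1 _ _
        neg' := fun x => by rw [map_neg, map_neg_eq_map]
        smul' := fun c x => by rw [dualConvAdd_smul, map_smul_eq_mul] }
    have hq : IsCStarSeminorm q ∧ ∀ x, q x ≤ ConvAlg.l1Norm x :=
      ⟨⟨fun x y => by
          change p.1 (dualConvAdd ζ (x * y)) ≤ _
          rw [dualConvAdd_mul]; exact p.2.1.mul_le _ _,
        fun x => by
          change p.1 (dualConvAdd ζ (star x * x)) = _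
          rw [dualConvAdd_mul, dualConvAdd_star]; exact p.2.1.star_mul_self _⟩,
        fun x => (p.2.2 _).trans (l1Norm_dualConvAdd ζ x).le⟩
    exact ConvAlg.le_univNorm ⟨q, hq⟩ x

theorem uniformContinuous_dualConvAdd (ζ : Circle) :
    UniformContinuous (dualConvAdd (θ := θ) ζ) :=
  (AddMonoidHomClass.lipschitz_of_bound (dualConvAdd (θ := θ) ζ) 1 fun x => by
    rw [one_mul]; exact univNorm_dualConvAdd_le ζ x).uniformContinuous

/-- The map of `B ⋊_θ ℤ` extending `dualConvAdd ζ`. -/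
noncomputable def dualMap (ζ : Circle) : CStarCrossedProduct θ → CStarCrossedProduct θ :=
  Completion.map (dualConvAdd (θ := θ) ζ)

theorem dualMap_ofConv (ζ : Circle) (x : ConvAlg θ) :
    dualMap ζ (ofConv x) = ofConv (dualConvAdd ζ x) :=
  Completion.map_coe (uniformContinuous_dualConvAdd ζ) x

theorem continuous_dualMap (ζ : Circle) : Continuous (dualMap (θ := θ) ζ) :=
  Completion.continuous_map

theorem dualMap_one (x : CStarCrossedProduct θ) : dualMap 1 x = x :=
  induction_ofConv (P := fun x => dualMap 1 x = x) x
    (isClosed_eq (continuous_dualMap 1) continuous_id) fun y => by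
    rw [dualMap_ofConv, dualConvAdd_one]

theorem dualMap_mul (ζ η : Circle) (x : CStarCrossedProduct θ) :
    dualMap (ζ * η) x = dualMap ζ (dualMap η x) :=
  induction_ofConv (P := fun x => dualMap (ζ * η) x = dualMap ζ (dualMap η x)) x
    (isClosed_eq (continuous_dualMap _)
    ((continuous_dualMap ζ).comp (continuous_dualMap η))) fun y => by
    rw [dualMap_ofConv, dualMap_ofConv, dualMap_ofConv, dualConvAdd_comp]

/-- The automorphism `θ̂_ζ` of `B ⋊_θ ℤ`. -/
noncomputable def dualAut (ζ : Circle) : CStarCrossedProduct θ ≃⋆ₐ[ℂ] CStarCrossedProduct θ where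
  toFun := dualMap ζ
  invFun := dualMap ζ⁻¹
  left_inv x := by rw [← dualMap_mul, inv_mul_cancel, dualMap_one]
  right_inv x := by rw [← dualMap_mul, mul_inv_cancel, dualMap_one]
  map_mul' x y := by
    refine induction_ofConv₂ (P := fun x y => dualMap ζ (x * y) = dualMap ζ x * dualMap ζ y) x y
      (isClosed_eq ((continuous_dualMap ζ).comp (continuous_fst.mul continuous_snd))
        (((continuous_dualMap ζ).comp continuous_fst).mul
          ((continuous_dualMap ζ).comp continuous_snd))) fun a b => ?_
    rw [← ofConv_mul, dualMap_ofConv, dualMap_ofConv, dualMap_ofConv, dualConvAdd_mul, ofConv_mul]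
  map_add' x y := by
    refine induction_ofConv₂ (P := fun x y => dualMap ζ (x + y) = dualMap ζ x + dualMap ζ y) x y
      (isClosed_eq ((continuous_dualMap ζ).comp (continuous_fst.add continuous_snd))
        (((continuous_dualMap ζ).comp continuous_fst).add
          ((continuous_dualMap ζ).comp continuous_snd))) fun a b => ?_
    rw [← ofConv_add, dualMap_ofConv, dualMap_ofConv, dualMap_ofConv, map_add, ofConv_add]
  map_star' x := by
    refine induction_ofConv (P := fun x => dualMap ζ (star x) = star (dualMap ζ x)) x
      (isClosed_eq ((continuous_dualMap ζ).comp continuous_star_aux)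
        (continuous_star_aux.comp (continuous_dualMap ζ))) fun y => ?_
    rw [← ofConv_star, dualMap_ofConv, dualMap_ofConv, dualConvAdd_star, ofConv_star]
  map_smul' c x := by
    refine induction_ofConv (P := fun x => dualMap ζ (c • x) = c • dualMap ζ x) x
      (isClosed_eq ((continuous_dualMap ζ).comp (continuous_const_smul c))
        ((continuous_dualMap ζ).const_smul c)) fun y => ?_
    rw [← ofConv_smul, dualMap_ofConv, dualMap_ofConv, dualConvAdd_smul, ofConv_smul]

variable (θ) in
/-- The dual action `θ̂` of the circle on `B ⋊_θ ℤ`, determined by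
`θ̂_ζ(b v^n) = ζ^n b v^n`, where `v` is the canonical unitary. -/
noncomputable def dualAction :
    Circle →* (CStarCrossedProduct θ ≃⋆ₐ[ℂ] CStarCrossedProduct θ) where
  toFun := dualAut
  map_one' := StarAlgEquiv.ext dualMap_one
  map_mul' ζ η := StarAlgEquiv.ext (dualMap_mul ζ η)

end CStarCrossedProduct

namespace CircleAction

/-- `φ : (A^α ⋊_θ ℤ, θ̂) → (A, α)` is an equivariant isomorphism that is the identity on `A^α`. -/
def IsPredualIso {A : Type*} [CStarAlgebra A] (α : Circle →* (A ≃⋆ₐ[ℂ] A))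
    (θ : fixedPoints α ≃⋆ₐ[ℂ] fixedPoints α) (φ : CStarCrossedProduct θ ≃⋆ₐ[ℂ] A) : Prop :=
  (∀ (ζ : Circle) (x : CStarCrossedProduct θ),
      φ (CStarCrossedProduct.dualAction θ ζ x) = α ζ (φ x)) ∧
    ∀ b : fixedPoints α, φ (CStarCrossedProduct.incl θ b) = (b : A)

end CircleAction

/-!
Averaging `ζ⁻¹ • α ζ u` over the circle, for a unitary `u` with `‖α ζ u - ζ • u‖ < 1`, gives an
invertible element that satisfies `α ζ x = ζ • x` exactly; since `star x * x` is fixed by `α`, the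
unitary `v` in the polar decomposition of `x` still satisfies `α ζ v = ζ • v`. Conjugation by `v`
restricts to an automorphism `θ` of the fixed point algebra, and the inclusion together with `v` is
a covariant pair, hence induces an equivariant homomorphism `φ` from the crossed product to `A`.

If `φ x = 0`, then each spectral component `y` of `x` is killed by `φ`, and so is `star y * y`,
which is fixed by the dual action. Fixed points of the dual action come from the coefficient
algebra, on which `φ` is injective; so `y = 0` for every component and `x = 0`. The range of `φ` is
closed and contains every spectral component `a` of weight `n`, because `a = (a * v⁻ⁿ) * vⁿ` with
`a * v⁻ⁿ` fixed; so `φ` is surjective.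

For uniqueness, the canonical unitaries of two such crossed products are sent to unitaries `v` and
`v'` of weight one, and `w = v * star v'` is fixed by `α`.
-/

section FourierCoefficients

open MeasureTheory AddCircle

variable {T : ℝ} [Fact (0 < T)] {E F : Type*} [NormedAddCommGroup E] [NormedSpace ℂ E]
  [NormedAddCommGroup F] [NormedSpace ℂ F] {f : AddCircle T → E}

omit [NormedSpace ℂ E] in
theorem integrable_haarAddCircle_of_continuous (hf : Continuous f) :
    Integrable f haarAddCircle :=
  hf.integrable_of_hasCompactSupport (HasCompactSupport.of_compactSpace _)

theorem map_fourierCoeff [CompleteSpace E] [CompleteSpace F] (L : E →L[ℂ] F)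
    (hf : Continuous f) (n : ℤ) : L (fourierCoeff f n) = fourierCoeff (fun t => L (f t)) n := by
  simpa only [map_smul] using!
    (L.integral_comp_comm ((integrable_haarAddCircle_of_continuous hf).fourier_smul (-n))).symm

theorem fourierCoeff_sub {g : AddCircle T → E} (hf : Integrable f haarAddCircle)
    (hg : Integrable g haarAddCircle) (n : ℤ) :
    fourierCoeff (fun t => f t - g t) n = fourierCoeff f n - fourierCoeff g n := by
  simp only [fourierCoeff, smul_sub]
  exact integral_sub (hf.fourier_smul _) (hg.fourier_smul _)

theorem norm_fourierCoeff_le {C : ℝ} (h : ∀ t, ‖f t‖ ≤ C) (n : ℤ) : ‖fourierCoeff f n‖ ≤ C := by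
  have hn (t : AddCircle T) : ‖fourier (-n) t • f t‖ ≤ C := by
    rw [norm_smul, fourier_apply, Circle.norm_coe, one_mul]
    exact h t
  exact (norm_integral_le_of_norm_le_const (.of_forall hn)).trans_eq (by simp)

theorem norm_fourierCoeff_lt (hf : Continuous f) {C : ℝ} (h : ∀ t, ‖f t‖ < C) (n : ℤ) :
    ‖fourierCoeff f n‖ < C := by
  obtain ⟨t, -, ht⟩ := isCompact_univ.exists_isMaxOn Set.univ_nonempty hf.norm.continuousOn
  exact (norm_fourierCoeff_le (fun s => ht (Set.mem_univ s)) n).trans_lt (h t)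

theorem fourierCoeff_comp_add_right (f : AddCircle T → E) (s : AddCircle T) (n : ℤ) :
    fourierCoeff (fun t => f (t + s)) n = fourier n s • fourierCoeff f n := by
  rw [fourierCoeff, fourierCoeff, ← integral_smul,
    ← integral_add_right_eq_self (fun t => fourier n s • fourier (-n) t • f t) s]
  refine integral_congr_ae (.of_forall fun t => ?_)
  simp only [smul_smul, fourier_apply, smul_add, toCircle_add, ← Circle.coe_mul, toCircle_zsmul]
  rw [mul_left_comm, zpow_neg (toCircle s), mul_inv_cancel, mul_one]

theorem fourierCoeff_fourier_smul [CompleteSpace E] (m : ℤ) (a : E) (n : ℤ) :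
    fourierCoeff (fun t : AddCircle T => fourier m t • a) n = (Pi.single m 1 : ℤ → ℂ) n • a := by
  rw [← fourierCoeff_fourier (T := T), fourierCoeff, fourierCoeff, ← integral_smul_const]
  simp only [smul_smul, smul_eq_mul]

theorem eq_zero_of_fourierCoeff_eq_zero [CompleteSpace E] (hf : Continuous f)
    (h : ∀ n, fourierCoeff f n = 0) (t : AddCircle T) : f t = 0 := by
  refine SeparatingDual.eq_zero_of_forall_dual_eq_zero (R := ℂ) fun L => ?_
  let g : C(AddCircle T, ℂ) := ⟨fun t => L (f t), L.continuous.comp hf⟩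
  have hg : fourierCoeff g = 0 := funext fun n =>
    (map_fourierCoeff L hf n).symm.trans ((congrArg L (h n)).trans (map_zero L))
  have hsum := has_pointwise_sum_fourier_series_of_summable (f := g) (hg ▸ summable_zero) t
  simp only [hg, Pi.zero_apply, zero_smul] at hsum
  exact hsum.unique hasSum_zero

theorem mem_of_fourierCoeff_mem [CompleteSpace E] {S : Submodule ℂ E}
    (hS : IsClosed (S : Set E)) (hf : Continuous f) (h : ∀ n, fourierCoeff f n ∈ S)
    (t : AddCircle T) : f t ∈ S := by
  have := hS
  rw [← Submodule.Quotient.mk_eq_zero]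
  refine eq_zero_of_fourierCoeff_eq_zero (f := fun t => S.mkQL (f t))
    (S.mkQL.continuous.comp hf) (fun n => ?_) t
  rw [← map_fourierCoeff S.mkQL hf]
  exact (Submodule.Quotient.mk_eq_zero S).2 (h n)

end FourierCoefficients

section UnitaryPart

variable {A : Type*} [CStarAlgebra A]

theorem isUnit_of_norm_sub_lt_one_of_mem_unitary {u x : A} (hu : u ∈ unitary A)
    (h : ‖x - u‖ < 1) : IsUnit x := by
  have hx : x = u * (1 - star u * (u - x)) := by
    rw [mul_sub, ← mul_assoc, Unitary.mul_star_self_of_mem hu, mul_one, one_mul, sub_sub_cancel]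
  rw [hx]
  refine (Unitary.isUnit_coe (U := ⟨u, hu⟩)).mul (isUnit_one_sub_of_norm_lt_one ?_)
  rwa [CStarRing.norm_mem_unitary_mul _ (Unitary.star_mem hu), norm_sub_rev]

theorem cfc_inv_sqrt_mul_self_mul_cfc_inv_sqrt {h : A} (hsa : IsSelfAdjoint h)
    (hpos : ∀ r ∈ spectrum ℝ h, 0 < r) :
    cfc (fun r : ℝ => (√r)⁻¹) h * h * cfc (fun r : ℝ => (√r)⁻¹) h = 1 := by
  have hc : ContinuousOn (fun r : ℝ => (√r)⁻¹) (spectrum ℝ h) :=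
    Real.continuous_sqrt.continuousOn.inv₀ fun r hr => (Real.sqrt_pos.2 (hpos r hr)).ne'
  calc cfc (fun r : ℝ => (√r)⁻¹) h * h * cfc (fun r : ℝ => (√r)⁻¹) h
      = cfc (fun r : ℝ => (√r)⁻¹ * r * (√r)⁻¹) h := by
        rw [cfc_mul (fun r : ℝ => (√r)⁻¹ * r) _ h (hc.mul continuousOn_id) hc,
          cfc_mul _ (fun r : ℝ => r) h hc continuousOn_id, cfc_id' ℝ h]
    _ = cfc 1 h := cfc_congr fun r hr => by
        have hr' := hpos r hr
        rw [Pi.one_apply, mul_right_comm, ← mul_inv, Real.mul_self_sqrt hr'.le,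
          inv_mul_cancel₀ hr'.ne']
    _ = 1 := cfc_one ℝ h

theorem spectrum_star_mul_self_pos_of_isUnit {x : A} (hx : IsUnit x) {r : ℝ}
    (hr : r ∈ spectrum ℝ (star x * x)) : 0 < r :=
  (spectrum_star_mul_self_nonneg r hr).lt_of_ne fun h0 =>
    (spectrum.zero_notMem_iff ℝ).2 (hx.star.mul hx) (h0 ▸ hr)

theorem mul_cfc_inv_sqrt_star_mul_self_mem_unitary {x : A} (hx : IsUnit x) :
    x * cfc (fun r : ℝ => (√r)⁻¹) (star x * x) ∈ unitary A := by
  have hinv := cfc_inv_sqrt_mul_self_mul_cfc_inv_sqrt (.star_mul_self x)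
    fun _ => spectrum_star_mul_self_pos_of_isUnit hx
  have hsa : IsSelfAdjoint (cfc (fun r : ℝ => (√r)⁻¹) (star x * x)) := cfc_predicate _ _
  set c := cfc (fun r : ℝ => (√r)⁻¹) (star x * x)
  have hc : IsUnit c := isUnit_iff_exists_and_exists.2
    ⟨⟨star x * x * c, by rw [← mul_assoc, hinv]⟩, ⟨c * (star x * x), hinv⟩⟩
  refine (hx.mul hc).mem_unitary_of_star_mul_self ?_
  rw [star_mul, hsa.star_eq, ← hinv]
  simp only [mul_assoc]

end UnitaryPart

namespace CircleAction

open AddCircle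
open scoped CStarAlgebra

variable {A : Type*} [CStarAlgebra A] {α : Circle →* (A ≃⋆ₐ[ℂ] A)} {m n : ℤ} {a b : A}

/-- The spectral subspace of weight `n`: the elements on which the action is multiplication by
the character `ζ ↦ ζ ^ n`. -/
def spectralSubspace (α : Circle →* (A ≃⋆ₐ[ℂ] A)) (n : ℤ) : Submodule ℂ A where
  carrier := {a | ∀ ζ : Circle, α ζ a = ((ζ ^ n : Circle) : ℂ) • a}
  add_mem' ha hb ζ := by rw [map_add, ha ζ, hb ζ, smul_add]
  zero_mem' ζ := by rw [map_zero, smul_zero]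
  smul_mem' c a ha ζ := by rw [map_smul, ha ζ, smul_comm]

theorem mem_spectralSubspace :
    a ∈ spectralSubspace α n ↔ ∀ ζ : Circle, α ζ a = ((ζ ^ n : Circle) : ℂ) • a := Iff.rfl

theorem mem_spectralSubspace_zero : a ∈ spectralSubspace α 0 ↔ a ∈ fixedPoints α := by
  simp only [mem_spectralSubspace, mem_fixedPoints, zpow_zero, Circle.coe_one, one_smul]

theorem mul_mem_spectralSubspace (ha : a ∈ spectralSubspace α m) (hb : b ∈ spectralSubspace α n) :
    a * b ∈ spectralSubspace α (m + n) := fun ζ => by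
  rw [map_mul, ha ζ, hb ζ, smul_mul_smul_comm, ← Circle.coe_mul, ← zpow_add]

theorem star_mem_spectralSubspace (ha : a ∈ spectralSubspace α n) :
    star a ∈ spectralSubspace α (-n) := fun ζ => by
  rw [map_star, ha ζ, star_smul, zpow_neg, Circle.coe_inv_eq_conj, starRingEnd_apply]

theorem star_mul_mem_fixedPoints (ha : a ∈ spectralSubspace α n)
    (hb : b ∈ spectralSubspace α n) : star a * b ∈ fixedPoints α := by
  simpa [mem_spectralSubspace_zero] using
    mul_mem_spectralSubspace (star_mem_spectralSubspace ha) hb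

theorem mul_star_mem_fixedPoints (ha : a ∈ spectralSubspace α n)
    (hb : b ∈ spectralSubspace α n) : a * star b ∈ fixedPoints α := by
  simpa [mem_spectralSubspace_zero] using
    mul_mem_spectralSubspace ha (star_mem_spectralSubspace hb)

theorem zpow_mem_spectralSubspace {v : unitary A} (hv : (v : A) ∈ spectralSubspace α n) (k : ℤ) :
    ((v ^ k : unitary A) : A) ∈ spectralSubspace α (k * n) := by
  induction k with
  | zero => simp [mem_spectralSubspace_zero]
  | succ k ih =>
    rw [zpow_add_one, add_one_mul]
    exact mul_mem_spectralSubspace ih hv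
  | pred k ih =>
    rw [zpow_sub_one, sub_one_mul]
    exact mul_mem_spectralSubspace ih (star_mem_spectralSubspace hv)

theorem unitaryPart_mem_spectralSubspace {x : A} (hx : x ∈ spectralSubspace α n) (f : ℝ → ℝ) :
    x * cfc f (star x * x) ∈ spectralSubspace α n := by
  simpa using mul_mem_spectralSubspace hx
    (mem_spectralSubspace_zero.2 (cfc_mem f (star_mul_mem_fixedPoints hx hx)))

section SpectralProj

variable (hα : ∀ a : A, Continuous fun ζ : Circle => α ζ a)
include hα

theorem continuous_orbit_toCircle (a : A) :
    Continuous fun t : UnitAddCircle => α (toCircle t) a :=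
  (hα a).comp continuous_toCircle

/-- The projection of `A` onto the spectral subspace of weight `n`: the average of
`ζ ^ (-n) • α ζ a` over the circle, written as the `n`-th Fourier coefficient of the orbit of `a`
under the parametrization of the circle by `ℝ / ℤ`. -/
noncomputable def spectralProj (n : ℤ) : A →L[ℂ] A :=
  LinearMap.mkContinuous
    { toFun a := fourierCoeff (fun t : UnitAddCircle => α (toCircle t) a) n
      map_add' a b := by
        simp only [map_add]
        exact congrFun (fourierCoeff.add
          (integrable_haarAddCircle_of_continuous (continuous_orbit_toCircle hα a))
          (integrable_haarAddCircle_of_continuous (continuous_orbit_toCircle hα b))) n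
      map_smul' c a := by
        simp only [map_smul]
        exact fourierCoeff.const_smul _ _ _ }
    1 fun a => norm_fourierCoeff_le (fun t => by rw [one_mul, StarAlgEquiv.norm_map]) n

theorem spectralProj_apply (n : ℤ) (a : A) :
    spectralProj hα n a = fourierCoeff (fun t : UnitAddCircle => α (toCircle t) a) n := rfl

theorem map_spectralProj {E F : Type*} [NormedAddCommGroup E] [NormedSpace ℂ E] [CompleteSpace E]
    [FunLike F A E] [ContinuousLinearMapClass F ℂ A E] (L : F) (n : ℤ) (a : A) :
    L (spectralProj hα n a) =
      fourierCoeff (fun t : UnitAddCircle => L (α (toCircle t) a)) n :=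
  map_fourierCoeff ⟨(L : A →ₗ[ℂ] E), map_continuous L⟩ (continuous_orbit_toCircle hα a) n

theorem spectralProj_mem_spectralSubspace (n : ℤ) (a : A) :
    spectralProj hα n a ∈ spectralSubspace α n := by
  intro ζ
  obtain ⟨s, rfl⟩ : ∃ s : UnitAddCircle, toCircle s = ζ := by
    simpa only [homeomorphCircle_apply] using (homeomorphCircle one_ne_zero).surjective ζ
  calc α (toCircle s) (spectralProj hα n a)
      = fourierCoeff (fun t : UnitAddCircle => α (toCircle s) (α (toCircle t) a)) n :=
        map_spectralProj hα (α (toCircle s)) n a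
    _ = fourierCoeff (fun t : UnitAddCircle => α (toCircle (t + s)) a) n := by
        simp only [add_comm _ s, toCircle_add, map_mul, StarAlgEquiv.mul_apply]
    _ = fourier n s • spectralProj hα n a :=
        fourierCoeff_comp_add_right (fun t : UnitAddCircle => α (toCircle t) a) s n
    _ = ((toCircle s ^ n : Circle) : ℂ) • spectralProj hα n a := by
        rw [fourier_apply, toCircle_zsmul]

theorem spectralProj_of_mem_spectralSubspace (ha : a ∈ spectralSubspace α m) (n : ℤ) :
    spectralProj hα n a = (Pi.single m 1 : ℤ → ℂ) n • a := by
  rw [spectralProj_apply, ← fourierCoeff_fourier_smul (T := 1)]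
  simp only [ha (toCircle _), fourier_apply, toCircle_zsmul]

theorem mem_of_forall_spectralProj_mem {S : Submodule ℂ A} (hS : IsClosed (S : Set A))
    (h : ∀ n, spectralProj hα n a ∈ S) : a ∈ S := by
  simpa using mem_of_fourierCoeff_mem hS (continuous_orbit_toCircle hα a) h 0

theorem norm_spectralProj_sub_lt {C : ℝ}
    (h : ∀ ζ : Circle, ‖α ζ a - ((ζ ^ n : Circle) : ℂ) • b‖ < C) :
    ‖spectralProj hα n a - b‖ < C := by
  have ha := continuous_orbit_toCircle hα a
  have hb : Continuous fun t : UnitAddCircle => fourier n t • b :=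
    (fourier n).continuous.smul continuous_const
  have hcoeff : fourierCoeff (fun t : UnitAddCircle => α (toCircle t) a - fourier n t • b) n =
      spectralProj hα n a - b := by
    rw [fourierCoeff_sub (integrable_haarAddCircle_of_continuous ha)
      (integrable_haarAddCircle_of_continuous hb), fourierCoeff_fourier_smul, Pi.single_eq_same,
      one_smul, spectralProj_apply]
  rw [← hcoeff]
  refine norm_fourierCoeff_lt (ha.sub hb) (fun t => ?_) n
  simpa only [Pi.sub_apply, fourier_apply, toCircle_zsmul] using h (toCircle t)

theorem exists_unitary_mem_spectralSubspace {u : A} (hu : u ∈ unitary A)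
    (h : ∀ ζ : Circle, ‖α ζ u - ((ζ ^ n : Circle) : ℂ) • u‖ < 1) :
    ∃ v : unitary A, (v : A) ∈ spectralSubspace α n :=
  have hunit : IsUnit (spectralProj hα n u) :=
    isUnit_of_norm_sub_lt_one_of_mem_unitary hu (norm_spectralProj_sub_lt hα h)
  ⟨⟨_, mul_cfc_inv_sqrt_star_mul_self_mem_unitary hunit⟩,
    unitaryPart_mem_spectralSubspace (spectralProj_mem_spectralSubspace hα n u) _⟩

theorem injective_of_injOn_fixedPoints {B : Type*} [CStarAlgebra B] (φ : A →⋆ₐ[ℂ] B)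
    (hφ : ∀ (ζ : Circle) (a : A), φ a = 0 → φ (α ζ a) = 0)
    (hinj : Set.InjOn φ (fixedPoints α)) : Function.Injective φ := by
  refine (injective_iff_map_eq_zero φ).2 fun a ha => ?_
  suffices h : ∀ n, spectralProj hα n a = 0 by
    simpa using mem_of_forall_spectralProj_mem hα (S := ⊥) isClosed_singleton
      fun n => (Submodule.mem_bot ℂ).2 (h n)
  intro n
  have hφn : φ (spectralProj hα n a) = 0 := by
    refine (map_spectralProj hα φ n a).trans ?_
    simp [hφ _ a ha, fourierCoeff]
  have hmem := spectralProj_mem_spectralSubspace hα n a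
  refine (CStarRing.star_mul_self_eq_zero_iff _).1
    (hinj (star_mul_mem_fixedPoints hmem hmem) (zero_mem _) ?_)
  rw [map_mul, hφn, mul_zero, map_zero]

end SpectralProj

end CircleAction

namespace CStarCrossedProduct

open CircleAction SkewMonoidAlgebra UniformSpace
open scoped CStarAlgebra

variable {A B : Type*} [CStarAlgebra A] [CStarAlgebra B] {θ : B ≃⋆ₐ[ℂ] B}

namespace ConvAlg

theorem norm_apply_le_l1Norm {f : ConvAlg θ →⋆ₐ[ℂ] A} (hf : ∀ n b, ‖f (single n b)‖ ≤ ‖b‖)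
    (x : ConvAlg θ) : ‖f x‖ ≤ l1Norm x := by
  conv_lhs => rw [← x.sum_single]
  rw [l1Norm, sum_def', sum_def', _root_.map_sum]
  exact norm_sum_le_of_le _ fun n _ => hf n _

theorem norm_apply_le {f : ConvAlg θ →⋆ₐ[ℂ] A} (hf : ∀ n b, ‖f (single n b)‖ ≤ ‖b‖)
    (x : ConvAlg θ) : ‖f x‖ ≤ ‖x‖ :=
  le_univNorm ⟨(normSeminorm ℂ A).comp f.toLinearMap,
    ⟨fun x y => (congrArg norm (map_mul f x y)).trans_le (norm_mul_le _ _),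
      fun x => by
        change ‖f (star x * x)‖ = ‖f x‖ ^ 2
        rw [map_mul, map_star, CStarRing.norm_star_mul_self, sq]⟩,
    norm_apply_le_l1Norm hf⟩ x

theorem continuous_of_norm_apply_single_le {f : ConvAlg θ →⋆ₐ[ℂ] A}
    (hf : ∀ n b, ‖f (single n b)‖ ≤ ‖b‖) : Continuous f :=
  AddMonoidHomClass.continuous_of_bound f 1 fun x => (norm_apply_le hf x).trans_eq (one_mul _).symm

end ConvAlg

/-- The extension of a continuous `⋆`-homomorphism on `C_c(ℤ, B, θ)` to `B ⋊_θ ℤ`. -/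
noncomputable def extend (f : ConvAlg θ →⋆ₐ[ℂ] A) (hf : Continuous f) :
    CStarCrossedProduct θ →⋆ₐ[ℂ] A :=
  let F : CStarCrossedProduct θ → A := Completion.extension f
  have hF : Continuous F := Completion.continuous_extension
  have hcoe (x : ConvAlg θ) : F (ofConv x) = f x :=
    Completion.extension_coe (uniformContinuous_addMonoidHom_of_continuous hf) x
  { toFun := F
    map_one' := by rw [← ofConv_one, hcoe, map_one]
    map_zero' := by rw [← ofConv_zero, hcoe, map_zero]
    map_mul' x y := by
      refine induction_ofConv₂ (P := fun x y => F (x * y) = F x * F y) x y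
        (isClosed_eq (by fun_prop) (by fun_prop)) fun a b => ?_
      rw [← ofConv_mul, hcoe, hcoe, hcoe, map_mul]
    map_add' x y := by
      refine induction_ofConv₂ (P := fun x y => F (x + y) = F x + F y) x y
        (isClosed_eq (by fun_prop) (by fun_prop)) fun a b => ?_
      rw [← ofConv_add, hcoe, hcoe, hcoe, map_add]
    map_star' x := by
      refine induction_ofConv (P := fun x => F (star x) = star (F x)) x
        (isClosed_eq (by fun_prop) (by fun_prop)) fun a => ?_
      rw [← ofConv_star, hcoe, hcoe, map_star]
    commutes' c := by
      rw [Algebra.algebraMap_eq_smul_one, ← ofConv_one, ← ofConv_smul, hcoe, map_smul, map_one,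
        Algebra.algebraMap_eq_smul_one] }

theorem extend_ofConv (f : ConvAlg θ →⋆ₐ[ℂ] A) (hf : Continuous f) (x : ConvAlg θ) :
    extend f hf (ofConv x) = f x :=
  Completion.extension_coe (uniformContinuous_addMonoidHom_of_continuous hf) x

theorem induction_single {P : CStarCrossedProduct θ → Prop} (x : CStarCrossedProduct θ)
    (isClosed : IsClosed {x | P x}) (single : ∀ n b, P (ofConv (single n b)))
    (add : ∀ y z, P y → P z → P (y + z)) : P x := by
  refine induction_ofConv x isClosed fun y => ?_
  induction y using SkewMonoidAlgebra.induction_on' with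
  | add y z hy hz => exact ofConv_add y z ▸ add _ _ hy hz
  | single n b => exact single n b

theorem ofConv_single_mem_spectralSubspace (n : IntAct θ) (b : B) :
    ofConv (single n b) ∈ spectralSubspace (dualAction θ) n.toInt := by
  intro ζ
  rw [← ofConv_smul, smul_single, ← dualConvAdd_single]
  exact dualMap_ofConv ζ _

variable (θ) in
theorem canonicalUnitary_mem_spectralSubspace :
    canonicalUnitary θ ∈ spectralSubspace (dualAction θ) 1 :=
  ofConv_single_mem_spectralSubspace (IntAct.of θ 1) 1

variable (θ) in
theorem canonicalUnitary_mem_unitary : canonicalUnitary θ ∈ unitary (CStarCrossedProduct θ) := by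
  rw [Unitary.mem_iff, canonicalUnitary, ← ofConv_star, ← ofConv_mul, ← ofConv_mul,
    ConvAlg.star_single, ConvAlg.single_mul_single', ConvAlg.single_mul_single', ← ofConv_one]
  simp only [inv_mul_cancel, mul_inv_cancel, star_one, smul_one, mul_one, one_def, and_self]

theorem semiconjBy_canonicalUnitary (b : B) :
    SemiconjBy (canonicalUnitary θ) (incl θ b) (incl θ (θ b)) := by
  rw [SemiconjBy, canonicalUnitary, incl, incl, ← ofConv_mul, ← ofConv_mul,
    ConvAlg.single_mul_single', ConvAlg.single_mul_single', smul_one, one_mul, mul_one, mul_comm]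
  rfl

variable (θ) in
/-- `incl θ` as a `⋆`-homomorphism. -/
noncomputable def inclHom : B →⋆ₐ[ℂ] CStarCrossedProduct θ where
  toFun := incl θ
  map_one' := rfl
  map_zero' := by rw [incl, single_zero, ofConv_zero]
  map_mul' b c := by
    rw [incl, incl, incl, ← ofConv_mul, ConvAlg.single_mul_single']
    rfl
  map_add' b c := by rw [incl, incl, incl, single_add, ofConv_add]
  map_star' b := by
    rw [incl, incl, ← ofConv_star, ConvAlg.star_single]
    rfl
  commutes' c := by
    rw [Algebra.algebraMap_eq_smul_one, Algebra.algebraMap_eq_smul_one, incl, ← smul_single,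
      ofConv_smul]
    rfl

theorem continuous_dualAction (x : CStarCrossedProduct θ) :
    Continuous fun ζ : Circle => dualAction θ ζ x := by
  have hdense (y : ConvAlg θ) : Continuous fun ζ : Circle => dualAction θ ζ (ofConv y) := by
    induction y using SkewMonoidAlgebra.induction_on' with
    | add y z hy hz =>
      simp only [ofConv_add, map_add]
      exact hy.add hz
    | single n b =>
      simp only [ofConv_single_mem_spectralSubspace n b _]
      have hz : Continuous fun ζ : Circle => ζ ^ n.toInt := continuous_zpow _
      exact Continuous.smul (continuous_induced_dom.comp hz) continuous_const
  refine continuous_of_uniform_approx_of_continuous fun u hu => ?_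
  obtain ⟨ε, hε, hεu⟩ := Metric.mem_uniformity_dist.1 hu
  obtain ⟨y, hy⟩ := Metric.denseRange_iff.1 denseRange_ofConv x ε hε
  refine ⟨_, hdense y, fun ζ => hεu ?_⟩
  rwa [(StarAlgEquiv.isometry (dualAction θ ζ)).dist_eq]

theorem fixedPoints_dualAction_le_range_inclHom (hincl : Function.Injective (inclHom θ)) :
    fixedPoints (dualAction θ) ≤ (inclHom θ).range := by
  have hclosed : IsClosed ((inclHom θ).range : Set (CStarCrossedProduct θ)) :=
    (NonUnitalStarAlgHom.isometry _ hincl).isClosedEmbedding.isClosed_range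
  have hproj (x : CStarCrossedProduct θ) :
      spectralProj continuous_dualAction 0 x ∈ (inclHom θ).range := by
    refine induction_single x
      (hclosed.preimage (spectralProj continuous_dualAction 0).continuous)
      (fun n b => ?_) fun y z hy hz => ?_
    · rw [spectralProj_of_mem_spectralSubspace _ (ofConv_single_mem_spectralSubspace n b)]
      obtain hn | hn := eq_or_ne n.toInt 0
      · obtain rfl : n = IntAct.of θ 0 := hn
        exact SMulMemClass.smul_mem _ ⟨b, rfl⟩
      · rw [Pi.single_eq_of_ne hn.symm, zero_smul]
        exact zero_mem _
    · rw [map_add]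
      exact add_mem hy hz
  intro x hx
  simpa [spectralProj_of_mem_spectralSubspace _ (mem_spectralSubspace_zero.2 hx)] using hproj x

/-- `(π, v)` is a covariant pair for `(B, θ)` if the unitary `v` implements `θ` in the
representation `π`, that is `v π(b) v⋆ = π(θ(b))`. -/
def IsCovariantPair (θ : B ≃⋆ₐ[ℂ] B) (π : B →⋆ₐ[ℂ] A) (v : unitary A) : Prop :=
  ∀ b, SemiconjBy (v : A) (π b) (π (θ b))

namespace IsCovariantPair

variable {π : B →⋆ₐ[ℂ] A} {v : unitary A} (h : IsCovariantPair θ π v)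
include h

theorem semiconjBy_inv (b : B) : SemiconjBy ((v⁻¹ : unitary A) : A) (π b) (π (θ⁻¹ b)) := by
  have hb := h (θ⁻¹ b)
  rw [← StarAlgEquiv.mul_apply, mul_inv_cancel, StarAlgEquiv.one_apply] at hb
  exact SemiconjBy.units_inv_symm_left (a := Unitary.toUnits v) hb

theorem semiconjBy_zpow (n : ℤ) (b : B) :
    SemiconjBy ((v ^ n : unitary A) : A) (π b) (π ((θ ^ n) b)) := by
  induction n generalizing b with
  | zero => simp
  | succ n ih =>
    rw [zpow_add_one, zpow_add_one]
    exact (ih (θ b)).mul_left (h b)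
  | pred n ih =>
    rw [zpow_sub_one, zpow_sub_one]
    exact (ih (θ⁻¹ b)).mul_left (h.semiconjBy_inv b)

/-- The integrated form `∑ b_n δ_n ↦ ∑ π(b_n) v^n` of a covariant pair. -/
noncomputable def integratedForm : ConvAlg θ →⋆ₐ[ℂ] A :=
  let f : ConvAlg θ →+* A := liftNCRingHom (π : B →+* A)
    ((unitary A).subtype.comp (zpowersHom (unitary A) v)) fun {b n} =>
      (h.semiconjBy_zpow n.toInt b).eq.symm
  have hf (n : IntAct θ) (b : B) : f (single n b) = π b * ((v ^ n.toInt : unitary A) : A) :=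
    liftNC_single _ _ _ _
  { f with
    map_star' x := by
      change f (star x) = star (f x)
      induction x using SkewMonoidAlgebra.induction_on' with
      | add x y hx hy => rw [star_add, map_add, hx, hy, map_add, star_add]
      | single n b =>
        rw [ConvAlg.star_single, hf, hf, star_mul, IntAct.smul_def, ← map_star π,
          ← Unitary.coe_star, Unitary.star_eq_inv, ← zpow_neg]
        exact (h.semiconjBy_zpow (-n.toInt) (star b)).eq.symm
    commutes' c := by
      change f _ = _
      rw [Algebra.algebraMap_eq_smul_one, one_def, smul_single, hf, map_smul, map_one,
        smul_one_mul, Algebra.algebraMap_eq_smul_one]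
      exact congrArg _ (congrArg _ (zpow_zero v)) }

theorem integratedForm_single (n : IntAct θ) (b : B) :
    h.integratedForm (single n b) = π b * ((v ^ n.toInt : unitary A) : A) :=
  liftNC_single _ _ _ _

theorem continuous_integratedForm : Continuous h.integratedForm :=
  ConvAlg.continuous_of_norm_apply_single_le fun n b => by
    rw [h.integratedForm_single, CStarRing.norm_mul_coe_unitary]
    exact NonUnitalStarAlgHom.norm_apply_le π b

/-- The `⋆`-homomorphism `b v^n ↦ π(b) v^n` of `B ⋊_θ ℤ` given by a covariant pair `(π, v)`. -/
noncomputable def lift : CStarCrossedProduct θ →⋆ₐ[ℂ] A :=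
  extend h.integratedForm h.continuous_integratedForm

theorem lift_ofConv_single (n : IntAct θ) (b : B) :
    h.lift (ofConv (single n b)) = π b * ((v ^ n.toInt : unitary A) : A) :=
  (extend_ofConv _ _ _).trans (h.integratedForm_single n b)

theorem lift_incl (b : B) : h.lift (incl θ b) = π b :=
  (h.lift_ofConv_single _ b).trans ((congrArg (π b * ·) (congrArg _ (zpow_zero v))).trans
    (mul_one _))

variable {α : Circle →* (A ≃⋆ₐ[ℂ] A)}

theorem injective_inclHom (hπ : Function.Injective π) : Function.Injective (inclHom θ) :=
  fun b c hbc => hπ ((h.lift_incl b).symm.trans ((congrArg h.lift hbc).trans (h.lift_incl c)))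

theorem map_dualAction_lift (hfix : ∀ b, π b ∈ fixedPoints α)
    (hv : (v : A) ∈ spectralSubspace α 1) (ζ : Circle) (x : CStarCrossedProduct θ) :
    h.lift (dualAction θ ζ x) = α ζ (h.lift x) := by
  refine induction_single (P := fun x => h.lift (dualAction θ ζ x) = α ζ (h.lift x)) x
    (isClosed_eq (by fun_prop) (by fun_prop)) (fun n b => ?_) fun y z hy hz => ?_
  · rw [ofConv_single_mem_spectralSubspace n b, map_smul, h.lift_ofConv_single, map_mul,
      hfix b ζ, zpow_mem_spectralSubspace hv, mul_one, mul_smul_comm]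
  · simp only [map_add, hy, hz]

theorem lift_injective (hπ : Function.Injective π) (hfix : ∀ b, π b ∈ fixedPoints α)
    (hv : (v : A) ∈ spectralSubspace α 1) : Function.Injective h.lift := by
  refine injective_of_injOn_fixedPoints continuous_dualAction h.lift
    (fun ζ x hx => by rw [h.map_dualAction_lift hfix hv, hx, map_zero]) fun x hx y hy hxy => ?_
  have hle := fixedPoints_dualAction_le_range_inclHom (h.injective_inclHom hπ)
  obtain ⟨b, rfl⟩ := hle hx
  obtain ⟨c, rfl⟩ := hle hy
  exact congrArg _ (hπ (((h.lift_incl b).symm.trans hxy).trans (h.lift_incl c)))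

theorem spectralSubspace_le_range_lift (hrange : fixedPoints α ≤ π.range)
    (hv : (v : A) ∈ spectralSubspace α 1) (n : ℤ) :
    spectralSubspace α n ≤ h.lift.range.toSubmodule := by
  intro a ha
  have hvn : ((v ^ n : unitary A) : A) ∈ spectralSubspace α n := by
    simpa only [mul_one] using zpow_mem_spectralSubspace hv n
  obtain ⟨b, hb⟩ := hrange (mul_star_mem_fixedPoints ha hvn)
  refine ⟨ofConv (single (IntAct.of θ n) b), (h.lift_ofConv_single _ b).trans ?_⟩
  calc π b * ((v ^ n : unitary A) : A)
      = a * star ((v ^ n : unitary A) : A) * (v ^ n : unitary A) := congrArg (· * _) hb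
    _ = a := by rw [mul_assoc, Unitary.coe_star_mul_self, mul_one]

theorem lift_bijective (hα : ∀ a : A, Continuous fun ζ : Circle => α ζ a)
    (hπ : Function.Injective π) (hrange : π.range = fixedPoints α)
    (hv : (v : A) ∈ spectralSubspace α 1) : Function.Bijective h.lift := by
  have hinj := h.lift_injective hπ (fun b => hrange.le ⟨b, rfl⟩) hv
  refine ⟨hinj, fun a => ?_⟩
  have hclosed : IsClosed (h.lift.range.toSubmodule : Set A) :=
    (NonUnitalStarAlgHom.isometry _ hinj).isClosedEmbedding.isClosed_range
  exact mem_of_forall_spectralProj_mem hα hclosed fun n =>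
    h.spectralSubspace_le_range_lift hrange.ge hv n (spectralProj_mem_spectralSubspace hα n a)

end IsCovariantPair

end CStarCrossedProduct

namespace CircleAction

open CStarCrossedProduct

variable {A : Type*} [CStarAlgebra A] {α : Circle →* (A ≃⋆ₐ[ℂ] A)} {n : ℤ}

theorem conj_mem_fixedPoints {v b : A} (hv : v ∈ spectralSubspace α n) (hb : b ∈ fixedPoints α) :
    v * b * star v ∈ fixedPoints α := by
  have hvb : v * b ∈ spectralSubspace α n := by
    simpa only [add_zero] using mul_mem_spectralSubspace hv (mem_spectralSubspace_zero.2 hb)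
  exact mul_star_mem_fixedPoints hvb hv

/-- The automorphism `b ↦ v b v⋆` of the fixed point algebra, for a unitary `v` of weight `n`. -/
noncomputable def conjFixedPoints {v : unitary A} (hv : (v : A) ∈ spectralSubspace α n) :
    fixedPoints α ≃⋆ₐ[ℂ] fixedPoints α :=
  let conj (n : ℤ) (v : unitary A) (hv : (v : A) ∈ spectralSubspace α n) :
      fixedPoints α →⋆ₐ[ℂ] fixedPoints α :=
    (((Unitary.conjStarAlgAut ℂ A v : A ≃⋆ₐ[ℂ] A) : A →⋆ₐ[ℂ] A).comp
      (fixedPoints α).subtype).codRestrict (fixedPoints α) fun b => conj_mem_fixedPoints hv b.2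
  StarAlgEquiv.ofStarAlgHom (conj n v hv) (conj (-n) (star v) (star_mem_spectralSubspace hv))
    (StarAlgHom.ext fun b => Subtype.ext <|
      (DFunLike.congr_fun (Unitary.conjStarAlgAut_symm v) _).symm.trans
        ((Unitary.conjStarAlgAut ℂ A v).symm_apply_apply (b : A)))
    (StarAlgHom.ext fun b => Subtype.ext <|
      (congrArg (Unitary.conjStarAlgAut ℂ A v)
        (DFunLike.congr_fun (Unitary.conjStarAlgAut_symm v) _).symm).trans
        ((Unitary.conjStarAlgAut ℂ A v).apply_symm_apply (b : A)))

theorem isCovariantPair_conjFixedPoints {v : unitary A} (hv : (v : A) ∈ spectralSubspace α n) :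
    IsCovariantPair (conjFixedPoints hv) (fixedPoints α).subtype v := fun b => by
  change (v : A) * b = v * b * star (v : A) * v
  rw [mul_assoc _ (star (v : A)), Unitary.coe_star_mul_self, mul_one]

theorem exists_isPredualIso (hα : ∀ a : A, Continuous fun ζ : Circle => α ζ a) {v : unitary A}
    (hv : (v : A) ∈ spectralSubspace α 1) :
    ∃ φ : CStarCrossedProduct (conjFixedPoints hv) ≃⋆ₐ[ℂ] A,
      IsPredualIso α (conjFixedPoints hv) φ :=
  have h := isCovariantPair_conjFixedPoints hv
  ⟨StarAlgEquiv.ofBijective h.lift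
    (h.lift_bijective hα Subtype.val_injective (SetLike.ext' Subtype.range_coe) hv),
    h.map_dualAction_lift Subtype.prop hv, h.lift_incl⟩

theorem IsPredualIso.exists_unitary {θ : fixedPoints α ≃⋆ₐ[ℂ] fixedPoints α}
    {φ : CStarCrossedProduct θ ≃⋆ₐ[ℂ] A} (hφ : IsPredualIso α θ φ) :
    ∃ v : unitary A, (v : A) ∈ spectralSubspace α 1 ∧
      ∀ b, (θ b : A) = v * b * star (v : A) := by
  have hunit := Unitary.map_mem φ (canonicalUnitary_mem_unitary θ)
  refine ⟨⟨_, hunit⟩, fun ζ => ?_, fun b => ?_⟩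
  · rw [← hφ.1, canonicalUnitary_mem_spectralSubspace θ ζ, map_smul]
  · rw [← hφ.2, ← hφ.2, ← map_mul, (semiconjBy_canonicalUnitary b).eq, map_mul, mul_assoc,
      Unitary.mul_star_self_of_mem hunit, mul_one]

theorem IsPredualIso.exists_unitary_conj {θ θ' : fixedPoints α ≃⋆ₐ[ℂ] fixedPoints α}
    {φ : CStarCrossedProduct θ ≃⋆ₐ[ℂ] A} {φ' : CStarCrossedProduct θ' ≃⋆ₐ[ℂ] A}
    (hφ : IsPredualIso α θ φ) (hφ' : IsPredualIso α θ' φ') :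
    ∃ w ∈ unitary (fixedPoints α), ∀ b, θ b = w * θ' b * star w := by
  obtain ⟨v, hv, hθ⟩ := hφ.exists_unitary
  obtain ⟨v', hv', hθ'⟩ := hφ'.exists_unitary
  have hw : ((v * star v' : unitary A) : A) ∈ unitary A := (v * star v').2
  refine ⟨⟨v * star (v' : A), mul_star_mem_fixedPoints hv hv'⟩,
    Unitary.mem_iff.2 ⟨Subtype.ext (Unitary.star_mul_self_of_mem hw),
      Subtype.ext (Unitary.mul_star_self_of_mem hw)⟩, fun b => Subtype.ext ?_⟩
  calc (θ b : A) = v * (star (v' : A) * v' * b * (star (v' : A) * v')) * star (v : A) := by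
        rw [hθ, Unitary.coe_star_mul_self, one_mul, mul_one]
    _ = v * star (v' : A) * θ' b * star (v * star (v' : A)) := by
        rw [hθ', star_mul, star_star]
        simp only [mul_assoc]

end CircleAction

theorem mainTheorem1_general {A : Type*} [CStarAlgebra A] (α : Circle →* (A ≃⋆ₐ[ℂ] A))
    (hα : ∀ a : A, Continuous fun ζ : Circle => α ζ a)
    {u : A} (hu : u ∈ unitary A) (hαu : ∀ ζ : Circle, ‖α ζ u - (ζ : ℂ) • u‖ < 1) :
    (∃ (θ : CircleAction.fixedPoints α ≃⋆ₐ[ℂ] CircleAction.fixedPoints α)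
        (φ : CStarCrossedProduct θ ≃⋆ₐ[ℂ] A), CircleAction.IsPredualIso α θ φ) ∧
    ∀ (θ θ' : CircleAction.fixedPoints α ≃⋆ₐ[ℂ] CircleAction.fixedPoints α)
      (φ : CStarCrossedProduct θ ≃⋆ₐ[ℂ] A) (φ' : CStarCrossedProduct θ' ≃⋆ₐ[ℂ] A),
      CircleAction.IsPredualIso α θ φ → CircleAction.IsPredualIso α θ' φ' →
      ∃ w ∈ unitary (CircleAction.fixedPoints α),
        ∀ b : CircleAction.fixedPoints α, θ b = w * θ' b * star w := by
  obtain ⟨v, hv⟩ := CircleAction.exists_unitary_mem_spectralSubspace (n := 1) hα hu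
    (by simpa only [zpow_one] using hαu)
  exact ⟨⟨_, CircleAction.exists_isPredualIso hα hv⟩,
    fun _ _ _ _ hφ hφ' => hφ.exists_unitary_conj hφ'⟩

theorem mainTheorem1 {A : Type*} [CStarAlgebra A] (α : Circle →* (A ≃⋆ₐ[ℂ] A))
    (hα : ∀ a : A, Continuous fun ζ : Circle => α ζ a)
    (hR : CircleAction.HasRokhlinProperty α) :
    (∃ (θ : CircleAction.fixedPoints α ≃⋆ₐ[ℂ] CircleAction.fixedPoints α)
        (φ : CStarCrossedProduct θ ≃⋆ₐ[ℂ] A), CircleAction.IsPredualIso α θ φ) ∧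
    ∀ (θ θ' : CircleAction.fixedPoints α ≃⋆ₐ[ℂ] CircleAction.fixedPoints α)
      (φ : CStarCrossedProduct θ ≃⋆ₐ[ℂ] A) (φ' : CStarCrossedProduct θ' ≃⋆ₐ[ℂ] A),
      CircleAction.IsPredualIso α θ φ → CircleAction.IsPredualIso α θ' φ' →
      ∃ w ∈ unitary (CircleAction.fixedPoints α),
        ∀ b : CircleAction.fixedPoints α, θ b = w * θ' b * star w := by
  obtain ⟨u, hu, hαu, -⟩ := hR 1 one_pos ∅
  exact mainTheorem1_general α hα hu hαu
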